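/- Let $d\in\mathbb{N}$ and let $\sigma(t)=\max\{0,t\}$. For a width $m$ consider the fully connected ReLU network whose input layer has width $d$ and whose hidden layers $1,2,3,\dots$ all have width $m$, with $l$-embeddings $$\alpha_m^{(0)}(x)=x,\qquad \alpha_m^{(l)}(x)=\frac{\sqrt2}{\sqrt m}\,\sigma\big(W_m^{(l)}\alpha_m^{(l-1)}(x)\big)\in\mathbb{R}^m\quad(l\ge1),$$ where, for each $m$, all entries of all the matrices $W_m^{(1)}\in\mathbb{R}^{m\times d}$, $W_m^{(l)}\in\mathbb{R}^{m\times m}$ $(l\ge2)$ are i.i.d. $\mathcal N(0,1)$ random variables (initialization). The network with $L$ hidden layers uses the layers $1,\dots,L$, and its last-layer embedding is $\alpha_m^{(L)}$. Let $$\theta_m^{(l)}(x,z)=\arccos\frac{\langle\alpha_m^{(l)}(x),\alpha_m^{(l)}(z)\rangle}{\|\alpha_m^{(l)}(x)\|\,\|\alpha_m^{(l)}(z)\|}$$ be the $l$-embedding angle (the quotient being read as $0$ when its denominator vanishes). Then: 1. For any two nonzero inputs $x,z\in\mathbb{R}^d$ and every $l\ge0$, $\theta_m^{(l)}(x,z)$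 converges in probability, as $m\to\infty$, to a deterministic number $\theta^{(l)}(x,z)$ (the embedding angle in the infinite-width limit). The sequence $\big(\theta^{(l)}(x,z)\big)_{l\ge0}$ is monotonically decreasing (non-increasing, and strictly decreasing if $\theta^{(0)}(x,z)\neq0$), and $$\lim_{L\to\infty}\theta^{(L)}(x,z)=0.$$ 2. In the limit of infinite width and then infinite depth, there is a vector $\alpha$, not depending on the input, such that $\alpha^{(L)}(x)=\|x\|\,\alpha$ for every input $x$. Precisely: there are random vectors $\alpha_{m,L}$ (with $\alpha_{m,L}$ in the same space as $\alpha_m^{(L)}(x)$) that do not depend on $x$, such that for every $x\in\mathbb{R}^d$ and every $L\ge0$ the distance $\big\|\alpha_m^{(L)}(x)-\|x\|\,\alpha_{m,L}\big\|$ converges in probability, as $m\to\infty$, to a deterministic number $\delta_L(x)$, and $\lim_{L\to\infty}\delta_L(x)=0$. -/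

import Mathlib

open MeasureTheory ProbabilityTheory Filter Topology

noncomputable section

/-- Layer widths of the network: the input layer `0` has width `d`, every hidden layer
`1, 2, 3, …` has width `m`. -/
def layerWidth (d m : ℕ) : ℕ → ℕ
  | 0 => d
  | _ + 1 => m

/-- The hidden-layer parameters: `W l` is the matrix that maps layer `l` to layer `l + 1`.
The hidden layers are indexed by all of `ℕ`; the network with `L` hidden layers uses the matrices
`W 0, …, W (L - 1)`, followed by a linear read-out that does not enter the embeddings. -/
abbrev HiddenWeights (d m : ℕ) : Type :=
  ∀ l : ℕ, Matrix (Fin (layerWidth d m (l + 1))) (Fin (layerWidth d m l)) ℝ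

/-- The ReLU activation function. -/
def relu (t : ℝ) : ℝ := max 0 t

/-- The `l`-embedding of the input `x`:
`α⁰(x) = x` and `αˡ⁺¹(x) = (√2 / √m) σ(W αˡ(x))`, with `σ` the ReLU applied entrywise and
`W` the weight matrix between the layers `l` and `l + 1`. -/
def embedding {d m : ℕ} (W : HiddenWeights d m) (x : EuclideanSpace ℝ (Fin d)) :
    ∀ l : ℕ, EuclideanSpace ℝ (Fin (layerWidth d m l))
  | 0 => x
  | l + 1 =>
    (√2 / √(layerWidth d m (l + 1) : ℝ)) •
      WithLp.toLp 2 (fun i => relu ((W l).mulVec (embedding W x l).ofLp i))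

/-- The `l`-embedding angle between the inputs `x` and `z`: the arccosine of
`⟪αˡ(x), αˡ(z)⟫ / (‖αˡ(x)‖ ‖αˡ(z)‖)`. -/
def embeddingAngle {d m : ℕ} (W : HiddenWeights d m) (x z : EuclideanSpace ℝ (Fin d))
    (l : ℕ) : ℝ :=
  Real.arccos (inner ℝ (embedding W x l) (embedding W z l) /
    (‖embedding W x l‖ * ‖embedding W z l‖))

/-- The random initialization of the parameters: all entries of all weight matrices are
independent, each with the law `N(0, 1)`. -/
structure IsGaussianInit {Ω : Type*} [MeasurableSpace Ω] (P : Measure Ω) {d m : ℕ}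
    (W : Ω → HiddenWeights d m) : Prop where
  indep : iIndepFun
    (fun (p : Σ l : ℕ, Fin (layerWidth d m (l + 1)) × Fin (layerWidth d m l)) (ω : Ω) =>
      W ω p.1 p.2.1 p.2.2) P
  law : ∀ (l : ℕ) (i : Fin (layerWidth d m (l + 1))) (j : Fin (layerWidth d m l)),
    HasLaw (fun ω => W ω l i j) (gaussianReal 0 1) P

end

noncomputable section

open scoped RealInnerProductSpace

/-! Given layer `l`, the rows of the next weight matrix are i.i.d. standard Gaussian vectors
independent of the embeddings `a`, `b` of the two inputs. The next inner product is thus `2 / m`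
times a sum of `m` i.i.d. terms, with conditional mean `2 * reluKernel a b`, which equals `‖a‖ * ‖b‖
* dualRelu c` for `c` the cosine between `a` and `b`. Chebyshev's inequality with a dimension-free
variance bound, and induction on `l`, give convergence in probability of the inner products to `‖x‖
* ‖z‖ * dualRelu^[l] c₀`, with `c₀` the cosine between the inputs
(`tendstoInMeasure_inner_embedding`). Norms and angles follow by continuous mapping.

The dynamics of `dualRelu` need no closed formula. From `relu t - relu (-t) = t` comes `2 *
reluKernel a b - 2 * reluKernel a (-b) = ⟪a, b⟫`, so `c < dualRelu c` for `c < 1`. Strict positivity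
of the mean square of `relu ⟪a, w⟫ - relu ⟪b, w⟫` gives `dualRelu c < 1`. The iterated cosines
therefore increase to a fixed point of the continuous map `dualRelu`, which must be `1`.

For the second claim, the common vector is the embedding of one fixed unit input `e`; expanding the
squared distance reduces it to the same cosines. -/

lemma relu_nonneg (t : ℝ) : 0 ≤ relu t := le_max_left _ _

lemma relu_le_abs (t : ℝ) : relu t ≤ |t| := max_le (abs_nonneg t) (le_abs_self t)

lemma continuous_relu : Continuous relu := continuous_const.max continuous_id

lemma relu_mul_of_nonneg {s : ℝ} (hs : 0 ≤ s) (t : ℝ) : relu (s * t) = s * relu t := by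
  simp [relu, mul_max_of_nonneg _ _ hs]

lemma relu_sub_relu_neg (t : ℝ) : relu t - relu (-t) = t := by
  rcases le_total 0 t with h | h <;> simp [relu, h]

/-- This norm determines the characteristic function of the Gaussian pair `(⟪x, w⟫, ⟪y, w⟫)`. The
expansion shows that it involves only the Gram matrix of `x` and `y`. -/
lemma norm_comp_innerSL_prod_sq {G : Type*} [NormedAddCommGroup G] [InnerProductSpace ℝ G]
    (x y : G) (L : StrongDual ℝ (ℝ × ℝ)) :
    ‖L ∘L ((innerSL ℝ x).prod (innerSL ℝ y))‖ ^ 2 =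
      (L (1, 0)) ^ 2 * ‖x‖ ^ 2 + 2 * (L (1, 0) * L (0, 1) * ⟪x, y⟫) +
        (L (0, 1)) ^ 2 * ‖y‖ ^ 2 := by
  have : L ∘L ((innerSL ℝ x).prod (innerSL ℝ y)) =
      innerSL ℝ (L (1, 0) • x + L (0, 1) • y) := by
    ext w
    have h : ((⟪x, w⟫, ⟪y, w⟫) : ℝ × ℝ) =
        ⟪x, w⟫ • ((1 : ℝ), (0 : ℝ)) + ⟪y, w⟫ • ((0 : ℝ), (1 : ℝ)) := by
      simp
    rw [ContinuousLinearMap.comp_apply, ContinuousLinearMap.prod_apply, innerSL_apply_apply,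
      innerSL_apply_apply, innerSL_apply_apply, h, map_add, map_smul, map_smul, smul_eq_mul,
      smul_eq_mul, inner_add_left, real_inner_smul_left, real_inner_smul_left]
    ring
  rw [this, innerSL_apply_norm, norm_add_sq_real, norm_smul, norm_smul, mul_pow, mul_pow,
    real_inner_smul_left, real_inner_smul_right]
  simp only [Real.norm_eq_abs, sq_abs]
  ring

section InnerProductSpace

variable {E : Type*} [NormedAddCommGroup E] [InnerProductSpace ℝ E]

lemma continuous_relu_inner (a : E) : Continuous (fun w : E => relu ⟪a, w⟫) :=
  continuous_relu.comp (by fun_prop)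

lemma abs_relu_inner_le (a w : E) : |relu ⟪a, w⟫| ≤ ‖a‖ * ‖w‖ := by
  rw [abs_of_nonneg (relu_nonneg _)]
  exact (relu_le_abs _).trans (abs_real_inner_le_norm a w)

lemma abs_relu_inner_mul_relu_inner_le (a b w : E) :
    |relu ⟪a, w⟫ * relu ⟪b, w⟫| ≤ ‖a‖ * ‖b‖ * ‖w‖ ^ 2 := by
  rw [abs_mul]
  calc _ ≤ (‖a‖ * ‖w‖) * (‖b‖ * ‖w‖) := by
        gcongr <;> exact abs_relu_inner_le _ _
    _ = _ := by ring

end InnerProductSpace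

/-! ### The ReLU kernel under the standard Gaussian measure -/

section StdGaussian

variable {E F : Type*}
  [NormedAddCommGroup E] [InnerProductSpace ℝ E] [FiniteDimensional ℝ E]
  [MeasurableSpace E] [BorelSpace E]
  [NormedAddCommGroup F] [InnerProductSpace ℝ F] [FiniteDimensional ℝ F]
  [MeasurableSpace F] [BorelSpace F]

/-- The two spaces may have different dimensions: this is what lets every computation be moved to
the plane. -/
lemma map_inner_pair_stdGaussian_eq (a b : E) (a' b' : F) (haa : ‖a‖ = ‖a'‖) (hbb : ‖b‖ = ‖b'‖)
    (hab : ⟪a, b⟫ = ⟪a', b'⟫) :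
    (stdGaussian E).map (fun w => (⟪a, w⟫, ⟪b, w⟫)) =
      (stdGaussian F).map (fun w => (⟪a', w⟫, ⟪b', w⟫)) := by
  apply Measure.ext_of_charFunDual
  ext L
  have h1 := charFunDual_map (μ := stdGaussian E) ((innerSL ℝ a).prod (innerSL ℝ b)) L
  have h2 := charFunDual_map (μ := stdGaussian F) ((innerSL ℝ a').prod (innerSL ℝ b')) L
  change charFunDual ((stdGaussian E).map ((innerSL ℝ a).prod (innerSL ℝ b))) L =
    charFunDual ((stdGaussian F).map ((innerSL ℝ a').prod (innerSL ℝ b'))) L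
  rw [h1, h2, charFunDual_stdGaussian, charFunDual_stdGaussian]
  have e : ‖L ∘L ((innerSL ℝ a).prod (innerSL ℝ b))‖ ^ 2 =
    ‖L ∘L ((innerSL ℝ a').prod (innerSL ℝ b'))‖ ^ 2 := by
    rw [norm_comp_innerSL_prod_sq, norm_comp_innerSL_prod_sq, haa, hbb, hab]
  rw [← Complex.ofReal_pow, ← Complex.ofReal_pow, e]

lemma integral_inner_pair_stdGaussian_eq (a b : E) (a' b' : F) (haa : ‖a‖ = ‖a'‖)
    (hbb : ‖b‖ = ‖b'‖) (hab : ⟪a, b⟫ = ⟪a', b'⟫) {f : ℝ → ℝ → ℝ}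
    (hf : Continuous (fun p : ℝ × ℝ => f p.1 p.2)) :
    ∫ w, f ⟪a, w⟫ ⟪b, w⟫ ∂stdGaussian E = ∫ w, f ⟪a', w⟫ ⟪b', w⟫ ∂stdGaussian F := by
  have h := map_inner_pair_stdGaussian_eq a b a' b' haa hbb hab
  have h1 := integral_map (μ := stdGaussian E) (φ := fun w => (⟪a, w⟫, ⟪b, w⟫))
    (f := fun p : ℝ × ℝ => f p.1 p.2) (by fun_prop) hf.aestronglyMeasurable
  have h2 := integral_map (μ := stdGaussian F) (φ := fun w => (⟪a', w⟫, ⟪b', w⟫))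
    (f := fun p : ℝ × ℝ => f p.1 p.2) (by fun_prop) hf.aestronglyMeasurable
  rw [← h1, ← h2, h]

lemma integrable_norm_pow_stdGaussian (n : ℕ) :
    Integrable (fun w : E => ‖w‖ ^ n) (stdGaussian E) :=
  ((IsGaussian.memLp_id (stdGaussian E) n (by simp)).integrable_norm_pow' :)

lemma integrable_stdGaussian_of_le {f : E → ℝ} (hf : Continuous f) (C : ℝ) (n : ℕ)
    (h : ∀ w, |f w| ≤ C * ‖w‖ ^ n) : Integrable f (stdGaussian E) :=
  ((integrable_norm_pow_stdGaussian n).const_mul C).mono' hf.aestronglyMeasurable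
    (ae_of_all _ h)

lemma integrable_relu_inner_mul (a b : E) :
    Integrable (fun w : E => relu ⟪a, w⟫ * relu ⟪b, w⟫) (stdGaussian E) :=
  integrable_stdGaussian_of_le ((continuous_relu_inner a).mul (continuous_relu_inner b))
    (‖a‖ * ‖b‖) 2 (abs_relu_inner_mul_relu_inner_le a b)

/-- The expectation `𝔼[σ(⟪a, w⟫) σ(⟪b, w⟫)]` for a standard Gaussian vector `w`. -/
def reluKernel (a b : E) : ℝ := ∫ w, relu ⟪a, w⟫ * relu ⟪b, w⟫ ∂stdGaussian E

lemma reluKernel_neg_neg (a b : E) : reluKernel (-a) (-b) = reluKernel a b :=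
  integral_inner_pair_stdGaussian_eq (-a) (-b) a b (norm_neg _) (norm_neg _) (by simp)
    (f := fun s t => relu s * relu t)
    ((continuous_relu.comp continuous_fst).mul (continuous_relu.comp continuous_snd))

lemma integral_inner_mul_inner_stdGaussian (a b : E) :
    ∫ w, ⟪a, w⟫ * ⟪b, w⟫ ∂stdGaussian E = ⟪a, b⟫ := by
  have h := covarianceBilin_apply (μ := stdGaussian E) IsGaussian.memLp_two_id a b
  have h0 : (stdGaussian E)[id] = 0 := integral_id_stdGaussian
  rw [covarianceBilin_stdGaussian, h0, innerSL_apply_apply] at h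
  simpa using h.symm

/-- Split each factor of `⟪a, w⟫ * ⟪b, w⟫` into positive and negative parts. The four resulting
kernels agree in pairs under `(a, b) ↦ (-a, -b)`. -/
lemma reluKernel_sub_reluKernel_neg (a b : E) :
    2 * reluKernel a b - 2 * reluKernel a (-b) = ⟪a, b⟫ := by
  have h : ∀ w : E, ⟪a, w⟫ * ⟪b, w⟫ =
      (relu ⟪a, w⟫ * relu ⟪b, w⟫ + relu ⟪-a, w⟫ * relu ⟪-b, w⟫) -
        (relu ⟪a, w⟫ * relu ⟪-b, w⟫ + relu ⟪-a, w⟫ * relu ⟪b, w⟫) := by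
    intro w
    rw [inner_neg_left, inner_neg_left]
    conv_lhs => rw [← relu_sub_relu_neg ⟪a, w⟫, ← relu_sub_relu_neg ⟪b, w⟫]
    ring
  rw [← integral_inner_mul_inner_stdGaussian a b]
  simp_rw [h]
  rw [integral_sub, integral_add, integral_add]
  · have h1 := reluKernel_neg_neg a b
    have h2 := reluKernel_neg_neg a (-b)
    rw [neg_neg] at h2
    simp only [reluKernel] at h1 h2 ⊢
    linarith
  all_goals first
    | exact integrable_relu_inner_mul _ _
    | exact (integrable_relu_inner_mul _ _).add (integrable_relu_inner_mul _ _)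

lemma reluKernel_self (a : E) : 2 * reluKernel a a = ‖a‖ ^ 2 := by
  have h : reluKernel a (-a) = 0 := by
    refine integral_eq_zero_of_ae (ae_of_all _ fun w => ?_)
    rcases le_total 0 ⟪a, w⟫ with h | h <;> simp [relu, h]
  have := reluKernel_sub_reluKernel_neg a a
  rw [h, real_inner_self_eq_norm_sq] at this
  linarith

omit [BorelSpace E] in
lemma reluKernel_smul_smul {s t : ℝ} (hs : 0 ≤ s) (ht : 0 ≤ t) (a b : E) :
    reluKernel (s • a) (t • b) = s * t * reluKernel a b := by
  simp only [reluKernel, real_inner_smul_left, relu_mul_of_nonneg hs, relu_mul_of_nonneg ht]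
  rw [← integral_const_mul]
  congr 1
  ext w
  ring

/-- With full support, a continuous nonnegative integrand that is positive at one point has a
positive integral; the strict inequalities below rest on this. -/
instance isOpenPosMeasure_stdGaussian : (stdGaussian E).IsOpenPosMeasure := by
  have h1 : (gaussianReal 0 1).IsOpenPosMeasure :=
    (gaussianReal_absolutelyContinuous' 0 one_ne_zero).isOpenPosMeasure
  have h2 : (stdGaussian (EuclideanSpace ℝ (Fin (Module.finrank ℝ E)))).IsOpenPosMeasure := by
    rw [← map_pi_eq_stdGaussian]
    exact (PiLp.continuous_toLp 2 _).isOpenPosMeasure_map (WithLp.toLp_surjective 2)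
  have h3 := (stdOrthonormalBasis ℝ E).repr.symm.continuous.isOpenPosMeasure_map
    (μ := stdGaussian (EuclideanSpace ℝ (Fin (Module.finrank ℝ E))))
    (stdOrthonormalBasis ℝ E).repr.symm.surjective
  rwa [stdGaussian_map] at h3

lemma integral_stdGaussian_pos {f : E → ℝ} (hf : Continuous f)
    (hi : Integrable f (stdGaussian E)) (h0 : ∀ w, 0 ≤ f w) {w : E} (hw : 0 < f w) :
    0 < ∫ x, f x ∂stdGaussian E :=
  (integral_pos_iff_support_of_nonneg h0 hi).2
    (hf.isOpen_support.measure_pos _ ⟨w, hw.ne'⟩)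

lemma reluKernel_pos {a b w : E} (ha : 0 < ⟪a, w⟫) (hb : 0 < ⟪b, w⟫) : 0 < reluKernel a b := by
  refine integral_stdGaussian_pos ((continuous_relu_inner a).mul (continuous_relu_inner b))
    (integrable_relu_inner_mul a b) (fun w => mul_nonneg (relu_nonneg _) (relu_nonneg _))
    (w := w) ?_
  simp [relu, ha, hb, ha.le, hb.le]

lemma inner_lt_two_mul_reluKernel {a b : E} (ha : ‖a‖ = 1) (hb : ‖b‖ = 1) (hab : ⟪a, b⟫ < 1) :
    ⟪a, b⟫ < 2 * reluKernel a b := by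
  have h := reluKernel_sub_reluKernel_neg a b
  have : 0 < reluKernel a (-b) := by
    -- For unit vectors, `a - b` has inner product `1 - ⟪a, b⟫ > 0` with both `a` and `-b`.
    refine reluKernel_pos (w := a - b) ?_ ?_
    · rw [inner_sub_right, real_inner_self_eq_norm_sq, ha]; linarith
    · rw [inner_neg_left, inner_sub_right, real_inner_self_eq_norm_sq, hb, real_inner_comm]
      linarith
  linarith

lemma two_mul_reluKernel_lt_one {a b : E} (ha : ‖a‖ = 1) (hb : ‖b‖ = 1) (hab : ⟪a, b⟫ < 1) :
    2 * reluKernel a b < 1 := by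
  have h : ∀ w : E, (relu ⟪a, w⟫ - relu ⟪b, w⟫) ^ 2 =
      relu ⟪a, w⟫ * relu ⟪a, w⟫ + relu ⟪b, w⟫ * relu ⟪b, w⟫ -
        2 * (relu ⟪a, w⟫ * relu ⟪b, w⟫) := fun w => by ring
  have hi : Integrable (fun w : E => (relu ⟪a, w⟫ - relu ⟪b, w⟫) ^ 2) (stdGaussian E) := by
    simp_rw [h]
    exact ((integrable_relu_inner_mul _ _).add (integrable_relu_inner_mul _ _)).sub
      ((integrable_relu_inner_mul _ _).const_mul 2)
  have hpos : 0 < ∫ w, (relu ⟪a, w⟫ - relu ⟪b, w⟫) ^ 2 ∂stdGaussian E := by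
    -- At `a - b` the first ReLU is active and the second vanishes.
    refine integral_stdGaussian_pos
      (((continuous_relu_inner a).sub (continuous_relu_inner b)).pow 2) hi
      (fun w => sq_nonneg _) (w := a - b) ?_
    have h1 : 0 < ⟪a, a - b⟫ := by
      rw [inner_sub_right, real_inner_self_eq_norm_sq, ha]; linarith
    have h2 : ⟪b, a - b⟫ < 0 := by
      rw [inner_sub_right, real_inner_self_eq_norm_sq, hb, real_inner_comm]; linarith
    simp only [relu, max_eq_right h1.le, max_eq_left h2.le, sub_zero]
    positivity
  simp_rw [h] at hpos
  rw [integral_sub, integral_add, integral_const_mul] at hpos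
  · have h1 := reluKernel_self a
    have h2 := reluKernel_self b
    rw [ha] at h1
    rw [hb] at h2
    simp only [reluKernel] at h1 h2 ⊢
    linarith
  all_goals first
    | exact integrable_relu_inner_mul _ _
    | exact (integrable_relu_inner_mul _ _).add (integrable_relu_inner_mul _ _)
    | exact (integrable_relu_inner_mul _ _).const_mul 2

end StdGaussian

/-! ### The cosine map of one infinitely wide layer -/

/-- The unit vector of the plane whose first coordinate is `c`, clamped to `[-1, 1]`. -/
def planeUnit (c : ℝ) : EuclideanSpace ℝ (Fin 2) :=
  !₂[max (-1) (min 1 c), √(1 - max (-1) (min 1 c) ^ 2)]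

lemma continuous_planeUnit : Continuous planeUnit := by
  unfold planeUnit
  refine (PiLp.continuous_toLp 2 _).comp (continuous_pi fun i => ?_)
  fin_cases i <;> simp <;> fun_prop

lemma norm_planeUnit (c : ℝ) : ‖planeUnit c‖ = 1 := by
  have h1 : -1 ≤ max (-1) (min 1 c) := le_max_left _ _
  have h2 : max (-1) (min 1 c) ≤ 1 := max_le (by norm_num) (min_le_left _ _)
  have h : 0 ≤ 1 - max (-1) (min 1 c) ^ 2 := by nlinarith
  rw [EuclideanSpace.norm_eq, Real.sqrt_eq_one]
  simp [planeUnit, Fin.sum_univ_two, Real.sq_sqrt h]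

lemma inner_planeUnit_one {c : ℝ} (hc : c ∈ Set.Icc (-1) 1) :
    ⟪planeUnit 1, planeUnit c⟫ = c := by
  simp [planeUnit, PiLp.inner_apply, Fin.sum_univ_two, hc.1, hc.2]

/-- The map that sends the cosine of the angle between two inputs of an infinitely wide ReLU layer
to the cosine of the angle between its outputs. -/
def dualRelu (c : ℝ) : ℝ := 2 * reluKernel (planeUnit 1) (planeUnit c)

/-- Because of the clamping, `planeUnit c` is a unit vector for every real `c`, so `‖w‖ ^ 2`
dominates the integrand uniformly. -/
lemma continuous_dualRelu : Continuous dualRelu := by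
  refine continuous_const.mul (continuous_of_dominated (bound := fun w => ‖w‖ ^ 2)
    (fun c => (integrable_relu_inner_mul _ _).aestronglyMeasurable)
    (fun c => ae_of_all _ fun w => ?_) (integrable_norm_pow_stdGaussian 2)
    (ae_of_all _ fun w => ?_))
  · simpa [norm_planeUnit] using abs_relu_inner_mul_relu_inner_le (planeUnit 1) (planeUnit c) w
  · exact continuous_const.mul (continuous_relu.comp (continuous_planeUnit.inner continuous_const))

lemma dualRelu_one : dualRelu 1 = 1 := by
  rw [dualRelu, reluKernel_self, norm_planeUnit, one_pow]

lemma lt_dualRelu {c : ℝ} (hc : c ∈ Set.Ico (-1) 1) : c < dualRelu c := by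
  have h := inner_planeUnit_one (Set.Ico_subset_Icc_self hc)
  have := inner_lt_two_mul_reluKernel (norm_planeUnit 1) (norm_planeUnit c) (h.trans_lt hc.2)
  rwa [h] at this

lemma dualRelu_lt_one {c : ℝ} (hc : c ∈ Set.Ico (-1) 1) : dualRelu c < 1 :=
  two_mul_reluKernel_lt_one (norm_planeUnit 1) (norm_planeUnit c)
    ((inner_planeUnit_one (Set.Ico_subset_Icc_self hc)).trans_lt hc.2)

/-- If `a` or `b` is zero, the quotient is `0` by convention and the Gram matrices still agree. -/
lemma exists_plane_gram_eq {E : Type*} [NormedAddCommGroup E] [InnerProductSpace ℝ E] (a b : E) :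
    ∃ c ∈ Set.Icc (-1 : ℝ) 1, c = ⟪a, b⟫ / (‖a‖ * ‖b‖) ∧
      ‖a‖ = ‖‖a‖ • planeUnit 1‖ ∧ ‖b‖ = ‖‖b‖ • planeUnit c‖ ∧
      ⟪a, b⟫ = ⟪‖a‖ • planeUnit 1, ‖b‖ • planeUnit c⟫ := by
  have hc : ⟪a, b⟫ / (‖a‖ * ‖b‖) ∈ Set.Icc (-1 : ℝ) 1 :=
    abs_le.1 (abs_real_inner_div_norm_mul_norm_le_one a b)
  refine ⟨_, hc, rfl, by simp [norm_smul, norm_planeUnit], by simp [norm_smul, norm_planeUnit], ?_⟩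
  rw [real_inner_smul_left, real_inner_smul_right, inner_planeUnit_one hc]
  rcases eq_or_ne a 0 with rfl | ha
  · simp
  rcases eq_or_ne b 0 with rfl | hb
  · simp
  field_simp

/-! ### Concentration of one layer -/

section StdGaussian

variable {E : Type*} [NormedAddCommGroup E] [InnerProductSpace ℝ E] [FiniteDimensional ℝ E]
  [MeasurableSpace E] [BorelSpace E]

lemma two_mul_reluKernel_eq (a b : E) :
    2 * reluKernel a b = ‖a‖ * ‖b‖ * dualRelu (⟪a, b⟫ / (‖a‖ * ‖b‖)) := by
  obtain ⟨c, -, rfl, ha, hb, hab⟩ := exists_plane_gram_eq a b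
  have h : reluKernel a b = reluKernel (‖a‖ • planeUnit 1)
      (‖b‖ • planeUnit (⟪a, b⟫ / (‖a‖ * ‖b‖))) :=
    integral_inner_pair_stdGaussian_eq a b _ _ ha hb hab (f := fun s t => relu s * relu t)
      ((continuous_relu.comp continuous_fst).mul (continuous_relu.comp continuous_snd))
  rw [h, reluKernel_smul_smul (norm_nonneg _) (norm_nonneg _), dualRelu]
  ring

lemma integrable_relu_inner_mul_sq (a b : E) :
    Integrable (fun w : E => (relu ⟪a, w⟫ * relu ⟪b, w⟫) ^ 2) (stdGaussian E) := by
  refine integrable_stdGaussian_of_le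
    (((continuous_relu_inner a).mul (continuous_relu_inner b)).pow 2)
    ((‖a‖ * ‖b‖) ^ 2) 4 fun w => ?_
  have := abs_relu_inner_mul_relu_inner_le a b w
  rw [abs_pow]
  calc _ ≤ (‖a‖ * ‖b‖ * ‖w‖ ^ 2) ^ 2 := by gcongr
    _ = _ := by ring

lemma memLp_relu_inner_mul (a b : E) :
    MemLp (fun w : E => relu ⟪a, w⟫ * relu ⟪b, w⟫) 2 (stdGaussian E) :=
  (memLp_two_iff_integrable_sq (integrable_relu_inner_mul a b).aestronglyMeasurable).2
    (integrable_relu_inner_mul_sq a b)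

/-- The fourth moment of the standard Gaussian vector in the plane. -/
def planeFourthMoment : ℝ :=
  ∫ w : EuclideanSpace ℝ (Fin 2), ‖w‖ ^ 4 ∂stdGaussian (EuclideanSpace ℝ (Fin 2))

lemma planeFourthMoment_nonneg : 0 ≤ planeFourthMoment := integral_nonneg fun _ => by positivity

/-- The constant must not depend on `E`, whose dimension is the width `m` in the hidden layers.
Bounding by the fourth moment of `‖w‖` in `E` itself would cost a factor of order `m ^ 2`, so the
pair is first moved to the plane. -/
lemma integral_relu_inner_mul_sq_le (a b : E) :
    ∫ w, (relu ⟪a, w⟫ * relu ⟪b, w⟫) ^ 2 ∂stdGaussian E ≤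
      (‖a‖ * ‖b‖) ^ 2 * planeFourthMoment := by
  obtain ⟨c, -, -, ha, hb, hab⟩ := exists_plane_gram_eq a b
  rw [integral_inner_pair_stdGaussian_eq a b _ _ ha hb hab (f := fun s t => (relu s * relu t) ^ 2)
    (((continuous_relu.comp continuous_fst).mul (continuous_relu.comp continuous_snd)).pow 2),
    planeFourthMoment, ← integral_const_mul]
  refine integral_mono (integrable_relu_inner_mul_sq _ _)
    ((integrable_norm_pow_stdGaussian 4).const_mul _) fun w => ?_
  have := abs_relu_inner_mul_relu_inner_le (‖a‖ • planeUnit 1) (‖b‖ • planeUnit c) w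
  rw [← ha, ← hb] at this
  dsimp only
  rw [← sq_abs]
  calc _ ≤ (‖a‖ * ‖b‖ * ‖w‖ ^ 2) ^ 2 := by gcongr
    _ = _ := by ring

lemma measure_layer_deviation_le {m : ℕ} (hm : 0 < m) (a b : E) {ε : ℝ} (hε : 0 < ε) :
    (Measure.pi fun _ : Fin m => stdGaussian E)
      {w | ε ≤ |2 / m * ∑ i, relu ⟪a, w i⟫ * relu ⟪b, w i⟫ - 2 * reluKernel a b|} ≤
    ENNReal.ofReal (4 * (‖a‖ * ‖b‖) ^ 2 * planeFourthMoment / (m * ε ^ 2)) := by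
  set μ := Measure.pi fun _ : Fin m => stdGaussian E
  have hm' : (0 : ℝ) < m := by exact_mod_cast hm
  have hL : ∀ i : Fin m, MemLp (fun w : Fin m → E => relu ⟪a, w i⟫ * relu ⟪b, w i⟫) 2 μ :=
    fun i => (memLp_relu_inner_mul a b).comp_measurePreserving (measurePreserving_eval _ i)
  have hS : MemLp (fun w : Fin m → E => 2 / m * ∑ i, relu ⟪a, w i⟫ * relu ⟪b, w i⟫) 2 μ :=
    (memLp_finsetSum _ fun i _ => hL i).const_mul _
  have hmean : ∫ w, 2 / m * ∑ i, relu ⟪a, w i⟫ * relu ⟪b, w i⟫ ∂μ = 2 * reluKernel a b := by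
    rw [integral_const_mul, integral_finsetSum _ fun i _ => (hL i).integrable one_le_two]
    have : ∀ i : Fin m, ∫ w, relu ⟪a, w i⟫ * relu ⟪b, w i⟫ ∂μ = reluKernel a b := fun i =>
      integral_comp_eval (μ := fun _ : Fin m => stdGaussian E)
        (f := fun w => relu ⟪a, w⟫ * relu ⟪b, w⟫)
        (integrable_relu_inner_mul a b).aestronglyMeasurable
    simp only [this, Finset.sum_const, Finset.card_univ, Fintype.card_fin, nsmul_eq_mul]
    field_simp
  have hvar : Var[fun w => 2 / m * ∑ i, relu ⟪a, w i⟫ * relu ⟪b, w i⟫; μ] ≤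
      4 * (‖a‖ * ‖b‖) ^ 2 * planeFourthMoment / m := by
    rw [variance_const_mul]
    have h1 := variance_sum_pi (μ := fun _ : Fin m => stdGaussian E)
      (X := fun _ w => relu ⟪a, w⟫ * relu ⟪b, w⟫) fun _ => memLp_relu_inner_mul a b
    have h2 : (∑ i, fun w : Fin m → E => relu ⟪a, w i⟫ * relu ⟪b, w i⟫) =
        fun w => ∑ i, relu ⟪a, w i⟫ * relu ⟪b, w i⟫ := by
      ext w; simp
    rw [h2] at h1
    rw [h1, Finset.sum_const, Finset.card_univ, Fintype.card_fin, nsmul_eq_mul]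
    have h3 : Var[fun w => relu ⟪a, w⟫ * relu ⟪b, w⟫; stdGaussian E] ≤
        (‖a‖ * ‖b‖) ^ 2 * planeFourthMoment :=
      (variance_le_expectation_sq (integrable_relu_inner_mul a b).aestronglyMeasurable).trans
        (integral_relu_inner_mul_sq_le a b)
    calc _ ≤ (2 / m : ℝ) ^ 2 * (m * ((‖a‖ * ‖b‖) ^ 2 * planeFourthMoment)) := by gcongr
      _ = _ := by field_simp; ring
  have h := meas_ge_le_variance_div_sq hS hε
  rw [hmean] at h
  refine h.trans (ENNReal.ofReal_le_ofReal ?_)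
  calc _ ≤ 4 * (‖a‖ * ‖b‖) ^ 2 * planeFourthMoment / m / ε ^ 2 := by gcongr
    _ = _ := by rw [div_div]

end StdGaussian

/-! ### Conditioning on an independent layer -/

section Independence

variable {Ω : Type*} [MeasurableSpace Ω] {P : Measure Ω}

lemma measure_mem_le_of_indepFun [IsFiniteMeasure P] {α β : Type*} [MeasurableSpace α]
    [MeasurableSpace β] {X : Ω → α} {Y : Ω → β} (hX : AEMeasurable X P) (hY : AEMeasurable Y P)
    (hXY : IndepFun X Y P) {B : Set (α × β)} (hB : MeasurableSet B) {t : ENNReal}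
    (ht : ∀ x, P.map Y (Prod.mk x ⁻¹' B) ≤ t) :
    P {ω | (X ω, Y ω) ∈ B} ≤ t * P Set.univ := by
  have h : P {ω | (X ω, Y ω) ∈ B} = P.map (fun ω => (X ω, Y ω)) B :=
    (Measure.map_apply_of_aemeasurable (hX.prodMk hY) hB).symm
  rw [h, (indepFun_iff_map_prod_eq_prod_map_map hX hY).1 hXY, Measure.prod_apply hB]
  calc _ ≤ ∫⁻ _, t ∂P.map X := lintegral_mono ht
    _ = _ := by
      rw [lintegral_const, Measure.map_apply_of_aemeasurable hX MeasurableSet.univ,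
        Set.preimage_univ]

/-- Fubini applies the fixed-vector bound for each value of `(a, b)`. The truncation at `K` makes
that bound uniform, as the variance bound scales with `(‖a‖ * ‖b‖) ^ 2`. -/
lemma measure_random_layer_deviation_le [IsProbabilityMeasure P] {E : Type*}
    [NormedAddCommGroup E] [InnerProductSpace ℝ E] [FiniteDimensional ℝ E] [MeasurableSpace E]
    [BorelSpace E] {m : ℕ} (hm : 0 < m) {a b : Ω → E} {G : Ω → Fin m → E}
    (ha : AEMeasurable a P) (hb : AEMeasurable b P)
    (hG : HasLaw G (Measure.pi fun _ => stdGaussian E) P)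
    (hind : IndepFun (fun ω => (a ω, b ω)) G P) {ε K : ℝ} (hε : 0 < ε) :
    P {ω | ‖a ω‖ * ‖b ω‖ ≤ K ∧ ε ≤ |2 / m * ∑ i, relu ⟪a ω, G ω i⟫ * relu ⟪b ω, G ω i⟫ -
        ‖a ω‖ * ‖b ω‖ * dualRelu (⟪a ω, b ω⟫ / (‖a ω‖ * ‖b ω‖))|} ≤
      ENNReal.ofReal (4 * K ^ 2 * planeFourthMoment / (m * ε ^ 2)) := by
  have hdual := continuous_dualRelu.measurable
  set B : Set ((E × E) × (Fin m → E)) := {q | ‖q.1.1‖ * ‖q.1.2‖ ≤ K ∧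
    ε ≤ |2 / m * ∑ i, relu ⟪q.1.1, q.2 i⟫ * relu ⟪q.1.2, q.2 i⟫ -
      ‖q.1.1‖ * ‖q.1.2‖ * dualRelu (⟪q.1.1, q.1.2⟫ / (‖q.1.1‖ * ‖q.1.2‖))|}
  have hB : MeasurableSet B := by
    have h : MeasurableSet {q : (E × E) × (Fin m → E) | ‖q.1.1‖ * ‖q.1.2‖ ≤ K} :=
      measurableSet_le (by fun_prop) measurable_const
    have h' : Measurable fun q : (E × E) × (Fin m → E) =>
        |2 / m * ∑ i, relu ⟪q.1.1, q.2 i⟫ * relu ⟪q.1.2, q.2 i⟫ -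
          ‖q.1.1‖ * ‖q.1.2‖ * dualRelu (⟪q.1.1, q.1.2⟫ / (‖q.1.1‖ * ‖q.1.2‖))| := by
      refine (Measurable.sub ?_ ?_).abs
      · refine (Finset.measurable_sum _ fun i _ => ?_).const_mul _
        exact ((continuous_relu.comp (by fun_prop)).mul
          (continuous_relu.comp (by fun_prop))).measurable
      · exact Measurable.mul (by fun_prop)
          (hdual.comp (Measurable.div (by fun_prop) (by fun_prop)))
    exact h.inter (measurableSet_le measurable_const h')
  have h := measure_mem_le_of_indepFun (ha.prodMk hb) hG.aemeasurable hind hB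
    (t := ENNReal.ofReal (4 * K ^ 2 * planeFourthMoment / (m * ε ^ 2))) fun q => ?_
  · rwa [measure_univ, mul_one] at h
  · rw [hG.map_eq]
    by_cases hK : ‖q.1‖ * ‖q.2‖ ≤ K
    · have h1 := measure_layer_deviation_le hm q.1 q.2 hε
      rw [two_mul_reluKernel_eq] at h1
      refine (measure_mono fun w hw => hw.2).trans (h1.trans (ENNReal.ofReal_le_ofReal ?_))
      have := planeFourthMoment_nonneg
      gcongr
    · have : Prod.mk q ⁻¹' B = ∅ := by
        ext w
        simp only [Set.mem_preimage, Set.mem_empty_iff_false, iff_false]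
        exact fun hw => hK hw.1
      rw [this, measure_empty]
      exact zero_le

end Independence

/-! ### Dependence of the embeddings on the weights -/

section Weights

variable {d m : ℕ}

/-- The rows of the weight matrix between the layers `l` and `l + 1`. -/
def weightRows (W : HiddenWeights d m) (l : ℕ) :
    Fin (layerWidth d m (l + 1)) → EuclideanSpace ℝ (Fin (layerWidth d m l)) :=
  fun i => WithLp.toLp 2 (W l i)

lemma weightRows_congr {W W' : HiddenWeights d m} {l : ℕ} (h : W l = W' l) :
    weightRows W l = weightRows W' l := by
  unfold weightRows
  rw [h]

lemma inner_embedding_succ (W : HiddenWeights d m) (x z : EuclideanSpace ℝ (Fin d)) (l : ℕ) :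
    ⟪embedding W x (l + 1), embedding W z (l + 1)⟫ =
      2 / (layerWidth d m (l + 1) : ℝ) * ∑ i, relu ⟪embedding W x l, weightRows W l i⟫ *
        relu ⟪embedding W z l, weightRows W l i⟫ := by
  have h : ∀ (y : EuclideanSpace ℝ (Fin d)) i,
      (W l).mulVec (embedding W y l).ofLp i = ⟪embedding W y l, weightRows W l i⟫ := by
    intro y i
    simp [Matrix.mulVec, dotProduct, weightRows, PiLp.inner_apply]
  simp only [embedding, h]
  rw [real_inner_smul_left, real_inner_smul_right, PiLp.inner_apply]
  rw [← mul_assoc, div_mul_div_comm, Real.mul_self_sqrt zero_le_two,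
    Real.mul_self_sqrt (Nat.cast_nonneg _)]
  simp [mul_comm]

lemma embedding_congr {W W' : HiddenWeights d m} (x : EuclideanSpace ℝ (Fin d)) {l : ℕ}
    (h : ∀ k < l, W k = W' k) : embedding W x l = embedding W' x l := by
  induction l with
  | zero => rfl
  | succ l ih => simp only [embedding, ih fun k hk => h k (hk.trans l.lt_succ_self),
      h l l.lt_succ_self]

lemma measurable_embedding {α : Type*} [MeasurableSpace α] {W : α → HiddenWeights d m}
    (hW : ∀ l i j, Measurable fun ω => W ω l i j) (x : EuclideanSpace ℝ (Fin d)) (l : ℕ) :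
    Measurable fun ω => embedding (W ω) x l := by
  induction l with
  | zero => exact measurable_const
  | succ l ih =>
    have hrelu := continuous_relu.measurable
    simp only [embedding]
    refine Measurable.const_smul (M := ℝ) ?_ _
    refine (WithLp.measurable_toLp 2 _).comp (measurable_pi_lambda _ fun i => hrelu.comp ?_)
    simp only [Matrix.mulVec, dotProduct]
    refine Finset.measurable_sum _ fun j _ => (hW l i j).mul ?_
    exact (measurable_pi_apply j).comp ((WithLp.measurable_ofLp 2 _).comp ih)

/-- The index type of all weights of the network. -/
abbrev WeightIndex (d m : ℕ) : Type :=
  Σ l : ℕ, Fin (layerWidth d m (l + 1)) × Fin (layerWidth d m l)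

/-- The weights of the network that agree with `v` on `S` and vanish outside `S`. -/
def extendWeights (S : Finset (WeightIndex d m)) (v : S → ℝ) : HiddenWeights d m :=
  fun l i j => if h : ⟨l, i, j⟩ ∈ S then v ⟨_, h⟩ else 0

lemma measurable_extendWeights (S : Finset (WeightIndex d m)) (l : ℕ)
    (i : Fin (layerWidth d m (l + 1))) (j : Fin (layerWidth d m l)) :
    Measurable fun v : S → ℝ => extendWeights S v l i j := by
  unfold extendWeights
  split_ifs with h
  · exact measurable_pi_apply _
  · exact measurable_const

lemma extendWeights_restrict (S : Finset (WeightIndex d m)) (W : HiddenWeights d m) {l : ℕ}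
    (h : ∀ i j, (⟨l, i, j⟩ : WeightIndex d m) ∈ S) :
    extendWeights S (fun p => W p.1.1 p.1.2.1 p.1.2.2) l = W l := by
  ext i j
  simp [extendWeights, h]

end Weights

/-! ### Independence and law of the rows at initialization -/

section Init

variable {Ω : Type*} [MeasurableSpace Ω] {P : Measure Ω} {d m : ℕ} {W : Ω → HiddenWeights d m}

lemma IsGaussianInit.aemeasurable_weight (hW : IsGaussianInit P W) (p : WeightIndex d m) :
    AEMeasurable (fun ω => W ω p.1 p.2.1 p.2.2) P :=
  (hW.law p.1 p.2.1 p.2.2).aemeasurable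

/-- Factoring through a finite vector of weights gives a.e. measurability of the embeddings, and
independence from the next layer via disjoint finite index sets. -/
lemma embedding_eq_extendWeights (W : HiddenWeights d m) (x : EuclideanSpace ℝ (Fin d)) (l : ℕ) :
    embedding W x l = embedding (extendWeights ((Finset.range l).sigma fun _ => Finset.univ)
      fun p => W p.1.1 p.1.2.1 p.1.2.2) x l :=
  embedding_congr x fun k hk => (extendWeights_restrict _ W (fun _ _ => by simpa using hk)).symm

lemma IsGaussianInit.aemeasurable_embedding (hW : IsGaussianInit P W)
    (x : EuclideanSpace ℝ (Fin d)) (l : ℕ) : AEMeasurable (fun ω => embedding (W ω) x l) P := by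
  have h := (measurable_embedding (measurable_extendWeights
    (((Finset.range l).sigma fun _ => Finset.univ : Finset (WeightIndex d m)))) x
      l).comp_aemeasurable (aemeasurable_pi_lambda _ fun p => hW.aemeasurable_weight p.1)
  exact h.congr (ae_of_all _ fun ω => (embedding_eq_extendWeights (W ω) x l).symm)

lemma IsGaussianInit.indepFun_embedding_weightRows (hW : IsGaussianInit P W)
    (x z : EuclideanSpace ℝ (Fin d)) (l : ℕ) :
    IndepFun (fun ω => (embedding (W ω) x l, embedding (W ω) z l))
      (fun ω => weightRows (W ω) l) P := by
  have h := iIndepFun.indepFun_finset₀ (ι := WeightIndex d m)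
    ((Finset.range l).sigma fun _ => Finset.univ) (({l} : Finset ℕ).sigma fun _ => Finset.univ)
    (by
      rw [Finset.disjoint_left]
      intro p hp hp'
      simp only [Finset.mem_sigma, Finset.mem_range, Finset.mem_singleton, Finset.mem_univ,
        and_true] at hp hp'
      omega) hW.indep hW.aemeasurable_weight
  have h' := h.comp
    (φ := fun v => (embedding (extendWeights _ v) x l, embedding (extendWeights _ v) z l))
    (ψ := fun v => weightRows (extendWeights _ v) l)
    ((measurable_embedding (measurable_extendWeights _) x l).prodMk
      (measurable_embedding (measurable_extendWeights _) z l))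
    (measurable_pi_lambda _ fun i => (WithLp.measurable_toLp 2 _).comp
      (measurable_pi_lambda _ fun j => measurable_extendWeights _ l i j))
  refine (h'.congr (ae_of_all _ fun ω => ?_) (ae_of_all _ fun ω => ?_))
  · exact Prod.ext (embedding_eq_extendWeights (W ω) x l).symm
      (embedding_eq_extendWeights (W ω) z l).symm
  · exact weightRows_congr (extendWeights_restrict _ (W ω) (by simp))

lemma IsGaussianInit.hasLaw_weightRows [IsProbabilityMeasure P] (hW : IsGaussianInit P W) (l : ℕ) :
    HasLaw (fun ω => weightRows (W ω) l) (Measure.pi fun _ => stdGaussian _) P := by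
  have hind : iIndepFun (fun (p : Fin (layerWidth d m (l + 1)) × Fin (layerWidth d m l)) ω =>
      W ω l p.1 p.2) P :=
    hW.indep.precomp (g := fun p => (⟨l, p⟩ : WeightIndex d m)) 
      fun _ _ h => eq_of_heq (Sigma.mk.inj h).2
  have hae : ∀ p : Fin (layerWidth d m (l + 1)) × Fin (layerWidth d m l),
      AEMeasurable (fun ω => W ω l p.1 p.2) P := fun p => (hW.law l p.1 p.2).aemeasurable
  have hlaw : HasLaw (fun ω (p : Fin (layerWidth d m (l + 1)) × Fin (layerWidth d m l)) =>
      W ω l p.1 p.2) (Measure.infinitePi fun _ => gaussianReal 0 1) P := by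
    refine ⟨aemeasurable_pi_lambda _ hae, ?_⟩
    rw [(iIndepFun_iff_map_fun_eq_pi_map hae).1 hind, Measure.infinitePi_eq_pi]
    congr 1
    ext1 p
    exact (hW.law l p.1 p.2).map_eq
  have hcurry : MeasurePreserving
      (MeasurableEquiv.curry (Fin (layerWidth d m (l + 1))) (Fin (layerWidth d m l)) ℝ)
      (Measure.infinitePi fun _ => gaussianReal 0 1)
      (Measure.pi fun _ => Measure.pi fun _ => gaussianReal 0 1) := by
    refine ⟨MeasurableEquiv.measurable _, ?_⟩
    rw [Measure.infinitePi_map_curry (fun _ _ => gaussianReal 0 1)]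
    simp_rw [Measure.infinitePi_eq_pi]
  have htoLp : MeasurePreserving (WithLp.toLp 2)
      (Measure.pi fun _ : Fin (layerWidth d m l) => gaussianReal 0 1) (stdGaussian _) :=
    ⟨WithLp.measurable_toLp 2 _, map_pi_eq_stdGaussian⟩
  -- Currying groups the i.i.d. entries into rows; each row is then a standard Gaussian vector.
  exact (measurePreserving_pi _ _ fun _ : Fin (layerWidth d m (l + 1)) => htoLp).comp_hasLaw
    (hcurry.comp_hasLaw hlaw)

lemma IsGaussianInit.measure_inner_embedding_succ_le [IsProbabilityMeasure P]
    (hW : IsGaussianInit P W) (hm : 0 < m) (x z : EuclideanSpace ℝ (Fin d)) (l : ℕ) {ε K : ℝ}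
    (hε : 0 < ε) :
    P {ω | ‖embedding (W ω) x l‖ * ‖embedding (W ω) z l‖ ≤ K ∧
        ε ≤ |⟪embedding (W ω) x (l + 1), embedding (W ω) z (l + 1)⟫ -
          ‖embedding (W ω) x l‖ * ‖embedding (W ω) z l‖ *
            dualRelu (⟪embedding (W ω) x l, embedding (W ω) z l⟫ /
              (‖embedding (W ω) x l‖ * ‖embedding (W ω) z l‖))|} ≤
      ENNReal.ofReal (4 * K ^ 2 * planeFourthMoment / (m * ε ^ 2)) := by
  simp_rw [inner_embedding_succ]
  exact measure_random_layer_deviation_le (m := layerWidth d m (l + 1)) hm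
    (hW.aemeasurable_embedding x l) (hW.aemeasurable_embedding z l) (hW.hasLaw_weightRows l)
    (hW.indepFun_embedding_weightRows x z l) hε

end Init

/-! ### Convergence in probability to constants -/

section TendstoInMeasure

variable {Ω : Type*} [MeasurableSpace Ω] {P : Measure Ω} {E F : Type*} [PseudoMetricSpace E]
  [PseudoMetricSpace F]

lemma tendstoInMeasure_const_iff_nhds {f : ℕ → Ω → E} {c : E} :
    TendstoInMeasure P f atTop (fun _ => c) ↔
      ∀ U ∈ 𝓝 c, Tendsto (fun m => P {ω | f m ω ∉ U}) atTop (𝓝 0) := by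
  rw [tendstoInMeasure_iff_dist]
  constructor
  · intro h U hU
    obtain ⟨ε, hε, hεU⟩ := Metric.mem_nhds_iff.1 hU
    refine tendsto_of_tendsto_of_tendsto_of_le_of_le tendsto_const_nhds (h ε hε)
      (fun _ => zero_le) fun m => measure_mono fun ω hω => ?_
    exact not_lt.1 fun hlt : dist (f m ω) c < ε => hω (hεU hlt)
  · intro h ε hε
    have := h _ (Metric.ball_mem_nhds c hε)
    simpa only [Metric.mem_ball, not_lt] using this

lemma TendstoInMeasure.prodMk_const {f : ℕ → Ω → E} {g : ℕ → Ω → F} {c : E} {c' : F}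
    (hf : TendstoInMeasure P f atTop (fun _ => c)) (hg : TendstoInMeasure P g atTop (fun _ => c')) :
    TendstoInMeasure P (fun m ω => (f m ω, g m ω)) atTop (fun _ => (c, c')) := by
  rw [tendstoInMeasure_const_iff_nhds] at hf hg ⊢
  intro U hU
  obtain ⟨V, hV, V', hV', hVU⟩ := mem_nhds_prod_iff.1 hU
  have h := (hf V hV).add (hg V' hV')
  rw [add_zero] at h
  refine tendsto_of_tendsto_of_tendsto_of_le_of_le tendsto_const_nhds h
    (fun _ => zero_le) fun m => (measure_mono fun ω hω => ?_).trans (measure_union_le _ _)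
  by_contra hcon
  simp only [Set.mem_union, Set.mem_ofPred_eq, not_or, not_not] at hcon
  exact hω (hVU hcon)

/-- Continuity at the limit point alone suffices. This matters for quotients by norms, which are
continuous only away from zero. -/
lemma TendstoInMeasure.continuousAt_comp_const {f : ℕ → Ω → E} {c : E} {φ : E → F}
    (hf : TendstoInMeasure P f atTop (fun _ => c)) (hφ : ContinuousAt φ c) :
    TendstoInMeasure P (fun m ω => φ (f m ω)) atTop (fun _ => φ c) := by
  rw [tendstoInMeasure_const_iff_nhds] at hf ⊢
  exact fun U hU => hf _ (hφ hU)

lemma tendstoInMeasure_const (c : E) :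
    TendstoInMeasure P (fun (_ : ℕ) (_ : Ω) => c) atTop (fun _ => c) :=
  tendstoInMeasure_const_iff_nhds.2 fun U hU => by simp [mem_of_mem_nhds hU]

end TendstoInMeasure

/-! ### Dynamics of the limiting cosine -/

/-- The cosine of the `l`-embedding angle between two inputs in the infinite-width limit. -/
def limitCosine {E : Type*} [NormedAddCommGroup E] [InnerProductSpace ℝ E] (x z : E) (l : ℕ) : ℝ :=
  dualRelu^[l] (⟪x, z⟫ / (‖x‖ * ‖z‖))

section LimitCosine

variable {E : Type*} [NormedAddCommGroup E] [InnerProductSpace ℝ E] (x z : E)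

lemma limitCosine_succ (l : ℕ) : limitCosine x z (l + 1) = dualRelu (limitCosine x z l) :=
  Function.iterate_succ_apply' _ _ _

lemma limitCosine_self {x : E} (hx : x ≠ 0) (l : ℕ) : limitCosine x x l = 1 := by
  induction l with
  | zero =>
    have := norm_ne_zero_iff.2 hx
    rw [limitCosine, Function.iterate_zero, id, real_inner_self_eq_norm_mul_norm,
      div_self (mul_ne_zero this this)]
  | succ l ih => rw [limitCosine_succ, ih, dualRelu_one]

lemma limitCosine_mem_Icc (l : ℕ) : limitCosine x z l ∈ Set.Icc (-1) 1 := by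
  induction l with
  | zero => exact abs_le.1 (abs_real_inner_div_norm_mul_norm_le_one x z)
  | succ l ih =>
    rw [limitCosine_succ]
    rcases ih.2.lt_or_eq with h | h
    · exact ⟨ih.1.trans (lt_dualRelu ⟨ih.1, h⟩).le, (dualRelu_lt_one ⟨ih.1, h⟩).le⟩
    · rw [h, dualRelu_one]; norm_num

lemma monotone_limitCosine : Monotone (limitCosine x z) := by
  refine monotone_nat_of_le_succ fun l => ?_
  have ih := limitCosine_mem_Icc x z l
  rw [limitCosine_succ]
  rcases ih.2.lt_or_eq with h | h
  · exact (lt_dualRelu ⟨ih.1, h⟩).le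
  · rw [h, dualRelu_one]

lemma limitCosine_lt_one (h0 : limitCosine x z 0 < 1) (l : ℕ) : limitCosine x z l < 1 := by
  induction l with
  | zero => exact h0
  | succ l ih =>
    rw [limitCosine_succ]
    exact dualRelu_lt_one ⟨(limitCosine_mem_Icc x z l).1, ih⟩

lemma strictMono_limitCosine (h0 : limitCosine x z 0 < 1) : StrictMono (limitCosine x z) := by
  refine strictMono_nat_of_lt_succ fun l => ?_
  rw [limitCosine_succ]
  exact lt_dualRelu ⟨(limitCosine_mem_Icc x z l).1, limitCosine_lt_one x z h0 l⟩

lemma tendsto_limitCosine : Tendsto (limitCosine x z) atTop (𝓝 1) := by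
  have h := tendsto_atTop_ciSup (monotone_limitCosine x z)
    ⟨1, Set.forall_mem_range.2 fun l => (limitCosine_mem_Icc x z l).2⟩
  set c := ⨆ l, limitCosine x z l
  have hc : c ∈ Set.Icc (-1 : ℝ) 1 :=
    isClosed_Icc.mem_of_tendsto h (Eventually.of_forall (limitCosine_mem_Icc x z))
  have h1 := (continuous_dualRelu.tendsto c).comp h
  have h2 : Tendsto (fun l => limitCosine x z (l + 1)) atTop (𝓝 c) :=
    h.comp (tendsto_add_atTop_nat 1)
  have h3 : dualRelu c = c :=
    tendsto_nhds_unique h1 (h2.congr fun l => limitCosine_succ x z l)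
  -- A fixed point below `1` would contradict `lt_dualRelu`.
  rcases hc.2.lt_or_eq with h4 | h4
  · exact absurd h3 (lt_dualRelu ⟨hc.1, h4⟩).ne'
  · rwa [← h4]

end LimitCosine

/-! ### The infinite-width limit -/

section InfiniteWidth

variable {Ω : Type*} [MeasurableSpace Ω] {P : Measure Ω} [IsProbabilityMeasure P]
  {d : ℕ} {W : ∀ m : ℕ, Ω → HiddenWeights d m}

omit [IsProbabilityMeasure P] in
lemma tendstoInMeasure_norm_of_inner_self {l : ℕ} {x : EuclideanSpace ℝ (Fin d)} (hx : x ≠ 0)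
    (h : TendstoInMeasure P (fun m ω => ⟪embedding (W m ω) x l, embedding (W m ω) x l⟫) atTop
      (fun _ => ‖x‖ * ‖x‖ * limitCosine x x l)) :
    TendstoInMeasure P (fun m ω => ‖embedding (W m ω) x l‖) atTop (fun _ => ‖x‖) := by
  have h1 := TendstoInMeasure.continuousAt_comp_const h Real.continuous_sqrt.continuousAt
  rw [limitCosine_self hx, mul_one, Real.sqrt_mul_self (norm_nonneg _)] at h1
  simpa only [real_inner_self_eq_norm_mul_norm, Real.sqrt_mul_self (norm_nonneg _)] using h1

/-- In the infinite-width limit the inner products of the embeddings become deterministic. -/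
theorem tendstoInMeasure_inner_embedding (hW : ∀ m, IsGaussianInit P (W m)) (l : ℕ)
    {x z : EuclideanSpace ℝ (Fin d)} (hx : x ≠ 0) (hz : z ≠ 0) :
    TendstoInMeasure P (fun m ω => ⟪embedding (W m ω) x l, embedding (W m ω) z l⟫) atTop
      (fun _ => ‖x‖ * ‖z‖ * limitCosine x z l) := by
  -- The step for `(x, z)` also uses the hypothesis for `(x, x)` and `(z, z)`, which controls the
  -- norms.
  induction l generalizing x z with
  | zero =>
    have hx' := norm_ne_zero_iff.2 hx
    have hz' := norm_ne_zero_iff.2 hz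
    have h : ‖x‖ * ‖z‖ * limitCosine x z 0 = ⟪x, z⟫ := by
      simp only [limitCosine, Function.iterate_zero, id]
      field_simp
    rw [h]
    exact tendstoInMeasure_const (P := P) (⟪x, z⟫)
  | succ l ih =>
    have hxz : 0 < ‖x‖ * ‖z‖ := mul_pos (norm_pos_iff.2 hx) (norm_pos_iff.2 hz)
    have hprod := TendstoInMeasure.continuousAt_comp_const
      (TendstoInMeasure.prodMk_const (tendstoInMeasure_norm_of_inner_self hx (ih hx hx))
        (tendstoInMeasure_norm_of_inner_self hz (ih hz hz)))
      (φ := fun p : ℝ × ℝ => p.1 * p.2) (by fun_prop)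
    -- The conditional mean given layer `l` converges to the claimed limit; `hdiff` shows that the
    -- fluctuation around it vanishes.
    have hmean := TendstoInMeasure.continuousAt_comp_const
      (TendstoInMeasure.prodMk_const hprod (ih hx hz))
      (φ := fun p : ℝ × ℝ => p.1 * dualRelu (p.2 / p.1))
      (continuousAt_fst.mul (continuous_dualRelu.continuousAt.comp
        (continuousAt_snd.div continuousAt_fst hxz.ne')))
    simp only [mul_div_cancel_left₀ _ hxz.ne', ← limitCosine_succ] at hmean
    have hdiff : TendstoInMeasure P (fun m ω =>
        ⟪embedding (W m ω) x (l + 1), embedding (W m ω) z (l + 1)⟫ -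
          ‖embedding (W m ω) x l‖ * ‖embedding (W m ω) z l‖ *
            dualRelu (⟪embedding (W m ω) x l, embedding (W m ω) z l⟫ /
              (‖embedding (W m ω) x l‖ * ‖embedding (W m ω) z l‖))) atTop (fun _ => (0 : ℝ)) := by
      rw [tendstoInMeasure_iff_norm]
      intro ε hε
      -- Truncation level `K = ‖x‖ * ‖z‖ + 1`: the product of norms tends to `‖x‖ * ‖z‖`, so
      -- exceeding `K` has vanishing probability, and Chebyshev's bound covers the rest.
      have h1 := tendstoInMeasure_const_iff_nhds.1 hprod (Set.Iic (‖x‖ * ‖z‖ + 1))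
        (Iic_mem_nhds (lt_add_one _))
      have h2 : Tendsto (fun m : ℕ => ENNReal.ofReal
          (4 * (‖x‖ * ‖z‖ + 1) ^ 2 * planeFourthMoment / (m * ε ^ 2))) atTop (𝓝 0) := by
        rw [← ENNReal.ofReal_zero]
        exact ENNReal.tendsto_ofReal (tendsto_const_nhds.div_atTop
          (tendsto_natCast_atTop_atTop.atTop_mul_const (by positivity)))
      have h3 := h1.add h2
      rw [add_zero] at h3
      refine tendsto_of_tendsto_of_tendsto_of_le_of_le' tendsto_const_nhds h3
        (Eventually.of_forall fun _ => zero_le) ?_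
      filter_upwards [eventually_gt_atTop 0] with m hm
      refine le_trans ?_ (add_le_add le_rfl ((hW m).measure_inner_embedding_succ_le hm x z l hε))
      refine (measure_mono fun ω hω => ?_).trans (measure_union_le _ _)
      by_cases hK : ‖embedding (W m ω) x l‖ * ‖embedding (W m ω) z l‖ ≤ ‖x‖ * ‖z‖ + 1
      · refine Or.inr ⟨hK, ?_⟩
        simpa only [sub_zero, Real.norm_eq_abs, Set.mem_ofPred_eq] using hω
      · exact Or.inl hK
    have h := TendstoInMeasure.continuousAt_comp_const
      (TendstoInMeasure.prodMk_const hdiff hmean) (φ := fun p : ℝ × ℝ => p.1 + p.2) (by fun_prop)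
    simpa only [sub_add_cancel, zero_add] using h

theorem tendstoInMeasure_norm_embedding (hW : ∀ m, IsGaussianInit P (W m)) (l : ℕ)
    {x : EuclideanSpace ℝ (Fin d)} (hx : x ≠ 0) :
    TendstoInMeasure P (fun m ω => ‖embedding (W m ω) x l‖) atTop (fun _ => ‖x‖) :=
  tendstoInMeasure_norm_of_inner_self hx (tendstoInMeasure_inner_embedding hW l hx hx)

theorem tendstoInMeasure_embeddingAngle (hW : ∀ m, IsGaussianInit P (W m)) (l : ℕ)
    {x z : EuclideanSpace ℝ (Fin d)} (hx : x ≠ 0) (hz : z ≠ 0) :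
    TendstoInMeasure P (fun m ω => embeddingAngle (W m ω) x z l) atTop
      (fun _ => Real.arccos (limitCosine x z l)) := by
  have hxz : ‖x‖ * ‖z‖ ≠ 0 := mul_ne_zero (norm_ne_zero_iff.2 hx) (norm_ne_zero_iff.2 hz)
  have h := TendstoInMeasure.continuousAt_comp_const
    (TendstoInMeasure.prodMk_const (TendstoInMeasure.prodMk_const
      (tendstoInMeasure_norm_embedding hW l hx) (tendstoInMeasure_norm_embedding hW l hz))
      (tendstoInMeasure_inner_embedding hW l hx hz))
    (φ := fun p : (ℝ × ℝ) × ℝ => Real.arccos (p.2 / (p.1.1 * p.1.2)))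
    (Real.continuous_arccos.continuousAt.comp
      (continuousAt_snd.div (by fun_prop) hxz))
  simp only [mul_div_cancel_left₀ _ hxz] at h
  exact h

lemma norm_sub_norm_smul_eq_sqrt {E : Type*} [NormedAddCommGroup E] [InnerProductSpace ℝ E]
    (a b : E) (t : ℝ) :
    ‖a - t • b‖ = √(‖a‖ ^ 2 - 2 * (t * ⟪a, b⟫) + t ^ 2 * ‖b‖ ^ 2) := by
  rw [← Real.sqrt_sq (norm_nonneg (a - t • b)), norm_sub_sq_real, real_inner_smul_right, norm_smul,
    mul_pow, Real.norm_eq_abs, sq_abs]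

theorem tendstoInMeasure_norm_embedding_sub (hW : ∀ m, IsGaussianInit P (W m)) (l : ℕ)
    {x e : EuclideanSpace ℝ (Fin d)} (hx : x ≠ 0) (he : ‖e‖ = 1) :
    TendstoInMeasure P (fun m ω => ‖embedding (W m ω) x l - ‖x‖ • embedding (W m ω) e l‖) atTop
      (fun _ => √(2 * ‖x‖ ^ 2 * (1 - limitCosine x e l))) := by
  have he0 : e ≠ 0 := norm_ne_zero_iff.1 (by rw [he]; exact one_ne_zero)
  have h := TendstoInMeasure.continuousAt_comp_const
    (TendstoInMeasure.prodMk_const (TendstoInMeasure.prodMk_const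
      (tendstoInMeasure_norm_embedding hW l hx) (tendstoInMeasure_norm_embedding hW l he0))
      (tendstoInMeasure_inner_embedding hW l hx he0))
    (φ := fun p : (ℝ × ℝ) × ℝ => √(p.1.1 ^ 2 - 2 * (‖x‖ * p.2) + ‖x‖ ^ 2 * p.1.2 ^ 2))
    (by fun_prop)
  have h1 : ‖x‖ ^ 2 - 2 * (‖x‖ * (‖x‖ * ‖e‖ * limitCosine x e l)) + ‖x‖ ^ 2 * ‖e‖ ^ 2 =
      2 * ‖x‖ ^ 2 * (1 - limitCosine x e l) := by
    rw [he]; ring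
  simp only [h1] at h
  simpa only [norm_sub_norm_smul_eq_sqrt] using h

end InfiniteWidth

lemma embedding_zero_input {d m : ℕ} (W : HiddenWeights d m) (l : ℕ) : embedding W 0 l = 0 := by
  induction l with
  | zero => rfl
  | succ l ih =>
    simp only [embedding, ih]
    ext i
    simp [relu]

end

/-! ### Assembly of the two claims -/

theorem mainTheorem10 {Ω : Type*} [MeasurableSpace Ω] (P : Measure Ω) [IsProbabilityMeasure P]
    (d : ℕ) (W : ∀ m : ℕ, Ω → HiddenWeights d m) (hW : ∀ m : ℕ, IsGaussianInit P (W m)) :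
    (∀ x z : EuclideanSpace ℝ (Fin d), x ≠ 0 → z ≠ 0 →
      ∃ θ : ℕ → ℝ,
        (∀ l : ℕ, TendstoInMeasure P (fun (m : ℕ) (ω : Ω) => embeddingAngle (W m ω) x z l)
          atTop (fun _ => θ l)) ∧
        Antitone θ ∧
        (θ 0 ≠ 0 → StrictAnti θ) ∧
        Tendsto θ atTop (𝓝 0)) ∧
    (∃ α : ∀ m L : ℕ, Ω → EuclideanSpace ℝ (Fin (layerWidth d m L)),
      (∀ m L : ℕ, AEMeasurable (α m L) P) ∧
      ∀ x : EuclideanSpace ℝ (Fin d), ∃ δ : ℕ → ℝ,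
        (∀ L : ℕ, TendstoInMeasure P
          (fun (m : ℕ) (ω : Ω) => ‖embedding (W m ω) x L - ‖x‖ • α m L ω‖)
          atTop (fun _ => δ L)) ∧
        Tendsto δ atTop (𝓝 0)) := by
  refine ⟨fun x z hx hz => ⟨fun l => Real.arccos (limitCosine x z l),
    fun l => tendstoInMeasure_embeddingAngle hW l hx hz,
    fun k l hkl => Real.antitone_arccos (monotone_limitCosine x z hkl),
    fun h0 k l hkl => ?_, ?_⟩, ?_⟩
  · have h1 : limitCosine x z 0 < 1 := not_le.1 fun h => h0 (Real.arccos_eq_zero.2 h)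
    exact Real.strictAntiOn_arccos (limitCosine_mem_Icc x z k) (limitCosine_mem_Icc x z l)
      (strictMono_limitCosine x z h1 hkl)
  · have h := (Real.continuous_arccos.tendsto 1).comp (tendsto_limitCosine x z)
    rwa [Real.arccos_one] at h
  -- For `d = 0` there is no unit vector, so norm one is asked for only when a nonzero input exists.
  · obtain ⟨e, he⟩ : ∃ e : EuclideanSpace ℝ (Fin d), ∀ x : EuclideanSpace ℝ (Fin d),
        x ≠ 0 → ‖e‖ = 1 := by
      by_cases h : ∃ x : EuclideanSpace ℝ (Fin d), x ≠ 0
      · obtain ⟨x, hx⟩ := h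
        exact ⟨‖x‖⁻¹ • x, fun _ _ => norm_smul_inv_norm (𝕜 := ℝ) hx⟩
      · exact ⟨0, fun x hx => absurd ⟨x, hx⟩ h⟩
    refine ⟨fun m L ω => embedding (W m ω) e L, fun m L => (hW m).aemeasurable_embedding e L,
      fun x => ⟨fun L => √(2 * ‖x‖ ^ 2 * (1 - limitCosine x e L)), fun L => ?_, ?_⟩⟩
    -- For the zero input, both the distance and its claimed limit are `0`.
    · rcases eq_or_ne x 0 with rfl | hx
      · simpa [embedding_zero_input] using tendstoInMeasure_const (P := P) (0 : ℝ)
      · exact tendstoInMeasure_norm_embedding_sub hW L hx (he x hx)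
    · have h := ((tendsto_limitCosine x e).const_sub 1).const_mul (2 * ‖x‖ ^ 2)
      rw [sub_self, mul_zero] at h
      have h' := (Real.continuous_sqrt.tendsto 0).comp h
      rwa [Real.sqrt_zero] at h'
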